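/- **Conventions.** For a finite point set $P\subset\mathbb{R}^n$ and $t\in\mathbb{R}$, the Vietoris–Rips complex $\mathrm{Rips}_t(P)$ consists of all nonempty $\sigma\subseteq P$ of diameter at most $t$; $\mathrm{Rips}(P)=(\mathrm{Rips}_t(P))_{t\in\mathbb R}$ is the Vietoris–Rips filtration. Homology $H_p=Z_p/B_p$ is (unreduced) simplicial homology with $\mathbb{Z}/2$ coefficients. $Q$ is an *$\varepsilon$-perturbation* of $P$ if there is a bijection $f:P\to Q$ with $\|x-f(x)\|_2\le\varepsilon$ for all $x\in P$. A *persistent $p$-basis* of a filtration $\mathcal{F}=(K_t)_{t\in\mathbb R}$ is a finite family of intervals $[b_j,d_j)$ ($b_j\in\mathbb R$, $b_j<d_j\le+\infty$) and cycles $\zeta_j\in Z_p(K_{b_j})$ such that $[\zeta_j]=0$ in $H_p(K_t)$ for $t\ge d_j$ and, for every $t$, the classes $[\zeta_j]$ with $t\in[b_j,d_j)$ form a basis of $H_p(K_t)$; that is, $H_p\mathcal{F}$ is the direct sum of the interval modules generated by the $\zeta_j$. The multiset of the $[b_j,d_j)$ is the *barcode* $B_p(\mathcal F)$. A *representative cycle*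 of a bar $[b,d)$ is a cycle that occurs with this interval in some persistent $p$-basis of $\mathcal F$. For a chain $\zeta$, $r(\zeta)$ is the radius of the smallest Euclidean sphere enclosing all vertices of $\zeta$. The *optimal radius* $r([b,d))$ is the minimum of $r(\zeta)$ over the representative cycles $\zeta$ of $[b,d)$. For $\delta\ge 0$, a *$\delta$-approximate representative* of $[b,d)$ is a cycle $\zeta$ for which there are $b'\in[b-\delta,b+\delta]$ and $d'\in[d-\delta,d+\delta]$ ($d'=+\infty$ if $d=+\infty$), $b'<d'$, such that $b'$ is the first index with $\zeta\in Z_p(K_{b'})$, the class of $\zeta$ in $H_p(K_{b'})$ is not the class of a cycle of $K_s$ for any $s<b-\delta$, and for $s\ge b'$ one has $[\zeta]=0$ in $H_p(K_s)$ if and only if $s\ge d'$. The *$\delta$-approximate radius* $r^{\delta}([b,d))$ is the minimum of $r(\zeta)$ over all $\delta$-approximate representatives ($\infty$ if there are none). A *$\delta$-matching* of two barcodes is a set of pairs of bars, one from each, in which every bar occurs at most once, such that paired bars $[b,d),[b',d')$ satisfy $|b-b'|\le\delta$ and $|d-d'|\le\delta$ (with $|\infty-\infty|=0$ and $|\infty-d|=\infty$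 for finite $d$), and every unpaired bar $[b,d)$ satisfies $d-b\le2\delta$. **Theorem (approximate stability of the $\ell_2$-radius, Vietoris–Rips filtrations).** Let $P,Q\subset\mathbb{R}^n$ be finite, let $\varepsilon\ge0$, let $Q$ be an $\varepsilon$-perturbation of $P$, and let $p\ge0$. Then the barcodes $B_p(\mathrm{Rips}(P))$ and $B_p(\mathrm{Rips}(Q))$ exist, and there is a $2\varepsilon$-matching $\mathcal{M}$ between them such that, whenever $[b,d)\in B_p(\mathrm{Rips}(P))$ and $[b',d')\in B_p(\mathrm{Rips}(Q))$ are matched by $\mathcal M$ and both have length greater than $4\varepsilon$, $$r^{4\varepsilon}([b,d))\le r([b',d'))+\varepsilon\qquad\text{and}\qquad r^{4\varepsilon}([b',d'))\le r([b,d))+\varepsilon .$$ -/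

import Mathlib

open scoped ENNReal NNReal

noncomputable section

namespace RipsStability

/-! ### Simplicial homology over `ℤ/2` -/

/-- Formal sums of finite vertex sets with coefficients in `ℤ/2`. All chain groups of all complexes
on the vertex type `V` live in this common space, so that the inclusion of a chain of a complex
into a larger complex is the identity. -/
abbrev Chain (V : Type*) : Type _ := Finset V →₀ ZMod 2

/-- The group `C_p(K)` of `p`-chains: formal sums of faces of `K` with `p + 1` vertices. -/
def chains {V : Type*} (K : PreAbstractSimplicialComplex V) (p : ℕ) :
    Submodule (ZMod 2) (Chain V) :=
  Finsupp.supported (ZMod 2) (ZMod 2) {σ | σ ∈ K ∧ σ.card = p + 1}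

open Classical in
/-- The (unreduced) simplicial boundary map: a simplex goes to the sum of its nonempty facets;
a vertex goes to `0`. -/
def boundary (V : Type*) : Chain V →ₗ[ZMod 2] Chain V :=
  Finsupp.linearCombination (ZMod 2) fun σ : Finset V =>
    ∑ v ∈ σ.filter (fun v => (σ.erase v).Nonempty), Finsupp.single (σ.erase v) (1 : ZMod 2)

/-- The cycle group `Z_p(K)`. -/
def cycles {V : Type*} (K : PreAbstractSimplicialComplex V) (p : ℕ) :
    Submodule (ZMod 2) (Chain V) :=
  chains K p ⊓ LinearMap.ker (boundary V)

/-- The boundary group `B_p(K)`. -/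
def boundaries {V : Type*} (K : PreAbstractSimplicialComplex V) (p : ℕ) :
    Submodule (ZMod 2) (Chain V) :=
  (chains K (p + 1)).map (boundary V)

/-- The class of a chain modulo `B_p(K)`. -/
def homologyClass {V : Type*} (K : PreAbstractSimplicialComplex V) (p : ℕ) :
    Chain V →ₗ[ZMod 2] (Chain V ⧸ boundaries K p) :=
  (boundaries K p).mkQ

/-- The homology group `H_p(K) = Z_p(K) / B_p(K)`, as the space of classes of `p`-cycles modulo
`B_p(K)`. -/
def homology {V : Type*} (K : PreAbstractSimplicialComplex V) (p : ℕ) :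
    Submodule (ZMod 2) (Chain V ⧸ boundaries K p) :=
  (cycles K p).map (homologyClass K p)

/-! ### Bars, persistent bases and barcodes of real-indexed filtrations -/

/-- A nonempty half-open interval `[birth, death)`, where `death = ⊤` stands for `+∞`. -/
structure Bar where
  /-- the left end point -/
  birth : ℝ
  /-- the right end point, possibly `+∞` -/
  death : WithTop ℝ
  /-- the interval is nonempty -/
  birth_lt_death : (birth : WithTop ℝ) < death

/-- `t ∈ [birth, death)`. -/
def Bar.Alive (I : Bar) (t : ℝ) : Prop := I.birth ≤ t ∧ (t : WithTop ℝ) < I.death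

/-- The length of the bar is greater than `a`. -/
def Bar.LongerThan (I : Bar) (a : ℝ) : Prop := ((I.birth + a : ℝ) : WithTop ℝ) < I.death

/-- The cycles `ζ j` form a persistent `p`-basis of the filtration `F` with bars `X j`: the
persistence module `H_p F` is the direct sum over `j` of the interval modules which are spanned by
the class of `ζ j` at the indices of the bar `X j` and are `0` elsewhere. Thus at every index `t`
the classes of the `ζ j` with `t ∈ X j` are a basis of `H_p(F t)`, and the class of `ζ j`
becomes `0` from the right end point of `X j` on. -/
structure IsPersistentBasis {V : Type*} (F : ℝ →o PreAbstractSimplicialComplex V) (p : ℕ)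
    {m : ℕ} (X : Fin m → Bar) (ζ : Fin m → Chain V) : Prop where
  /-- `ζ j` is a cycle of the complex at the birth of its bar -/
  cycle : ∀ j, ζ j ∈ cycles (F (X j).birth) p
  /-- the class of `ζ j` vanishes from the death of its bar on -/
  dead : ∀ (j : Fin m) (t : ℝ), (X j).death ≤ (t : WithTop ℝ) → homologyClass (F t) p (ζ j) = 0
  /-- the classes that are alive at `t` are linearly independent -/
  indep : ∀ t : ℝ, LinearIndependent (ZMod 2)
    (fun j : {j // (X j).Alive t} => homologyClass (F t) p (ζ j))
  /-- the classes that are alive at `t` span the homology at `t` -/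
  span : ∀ t : ℝ, Submodule.span (ZMod 2)
    (Set.range fun j : {j // (X j).Alive t} => homologyClass (F t) p (ζ j)) = homology (F t) p

/-- The family `X` (a multiset of bars, listed with multiplicity) is the barcode `B_p(F)`: the
module `H_p F` decomposes as the direct sum of the interval modules of the `X j`. The cycles `ζ j`
represent the images of the generators of the summands under the isomorphism. -/
def IsBarcode {V : Type*} (F : ℝ →o PreAbstractSimplicialComplex V) (p : ℕ)
    {m : ℕ} (X : Fin m → Bar) : Prop :=
  ∃ ζ : Fin m → Chain V, IsPersistentBasis F p X ζ

/-- `ζ` is a representative cycle of the bar `I`: it belongs, with the bar `I`, to some persistent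
`p`-basis of `F`. -/
def IsRepresentative {V : Type*} (F : ℝ →o PreAbstractSimplicialComplex V) (p : ℕ)
    (I : Bar) (ζ : Chain V) : Prop :=
  ∃ (m : ℕ) (X : Fin m → Bar) (z : Fin m → Chain V),
    IsPersistentBasis F p X z ∧ ∃ j, X j = I ∧ z j = ζ

/-- `ζ` is a `δ`-approximate representative of the bar `I = [b, d)`: a cycle that is born at some
`b' ∈ [b - δ, b + δ]`, dies at some `d' ∈ [d - δ, d + δ]` (with `d' = +∞` iff `d = +∞`), and whose
class is nontrivial at every index in `[b', d')`. The cycle is born at `b'` in the sense that `b'`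
is the first index at which it is a cycle of the complex; its homology class there must not be
older than the window `[b - δ, b + δ]` either. -/
def IsApproxRepresentative {V : Type*} (F : ℝ →o PreAbstractSimplicialComplex V) (p : ℕ)
    (δ : ℝ) (I : Bar) (ζ : Chain V) : Prop :=
  ∃ (b' : ℝ) (d' : WithTop ℝ),
    |b' - I.birth| ≤ δ ∧
    d' ≤ I.death + (δ : WithTop ℝ) ∧ I.death ≤ d' + (δ : WithTop ℝ) ∧
    (b' : WithTop ℝ) < d' ∧
    (∀ s : ℝ, ζ ∈ cycles (F s) p ↔ b' ≤ s) ∧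
    (∀ s < I.birth - δ, ∀ w ∈ cycles (F s) p,
      homologyClass (F b') p ζ ≠ homologyClass (F b') p w) ∧
    (∀ s : ℝ, b' ≤ s → (homologyClass (F s) p ζ = 0 ↔ d' ≤ (s : WithTop ℝ)))

/-! ### The `ℓ₂`-radius -/

/-- The `ℓ₂`-radius of a chain: the least radius of a Euclidean sphere that encloses all vertices
of the chain. -/
def chainRadius {V : Type*} [PseudoMetricSpace V] (ζ : Chain V) : ℝ≥0∞ :=
  ⨅ (c : V) (ρ : ℝ≥0) (_ : ∀ σ ∈ ζ.support, ∀ v ∈ σ, dist v c ≤ ρ), (ρ : ℝ≥0∞)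

/-- `r([b, d))`: the least `ℓ₂`-radius of a representative cycle of the bar. -/
def barRadius {V : Type*} [PseudoMetricSpace V] (F : ℝ →o PreAbstractSimplicialComplex V) (p : ℕ)
    (I : Bar) : ℝ≥0∞ :=
  ⨅ (ζ : Chain V) (_ : IsRepresentative F p I ζ), chainRadius ζ

/-- `r^δ([b, d))`: the least `ℓ₂`-radius of a `δ`-approximate representative of the bar. The
infimum over the empty family would be `∞`. -/
def approxBarRadius {V : Type*} [PseudoMetricSpace V] (F : ℝ →o PreAbstractSimplicialComplex V)
    (p : ℕ) (δ : ℝ) (I : Bar) : ℝ≥0∞ :=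
  ⨅ (ζ : Chain V) (_ : IsApproxRepresentative F p δ I ζ), chainRadius ζ

/-! ### Matchings -/

/-- `M` is a `δ`-matching between the barcodes `X` and `Y`: each bar occurs in at most one pair,
end points of matched bars differ by at most `δ` (two infinite right end points differ by `0`, an
infinite and a finite one by `∞`), and unmatched bars satisfy `(d - b) / 2 ≤ δ`. -/
structure IsMatching (δ : ℝ) {m k : ℕ} (X : Fin m → Bar) (Y : Fin k → Bar)
    (M : Set (Fin m × Fin k)) : Prop where
  /-- every bar of `X` occurs in at most one pair -/
  left_unique : ∀ i j j', (i, j) ∈ M → (i, j') ∈ M → j = j'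
  /-- every bar of `Y` occurs in at most one pair -/
  right_unique : ∀ i i' j, (i, j) ∈ M → (i', j) ∈ M → i = i'
  /-- left end points of matched bars are close -/
  birth_close : ∀ i j, (i, j) ∈ M → |(X i).birth - (Y j).birth| ≤ δ
  /-- right end points of matched bars are close -/
  death_close : ∀ i j, (i, j) ∈ M →
    (X i).death ≤ (Y j).death + (δ : WithTop ℝ) ∧ (Y j).death ≤ (X i).death + (δ : WithTop ℝ)
  /-- unmatched bars of `X` are short -/
  left_short : ∀ i, (∀ j, (i, j) ∉ M) → ¬ (X i).LongerThan (2 * δ)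
  /-- unmatched bars of `Y` are short -/
  right_short : ∀ j, (∀ i, (i, j) ∉ M) → ¬ (Y j).LongerThan (2 * δ)

/-! ### Vietoris–Rips filtrations and perturbations -/

/-- The Vietoris–Rips complex of a finite point set at scale `t`: all nonempty subsets of diameter
at most `t`. -/
def ripsComplex {V : Type*} [PseudoMetricSpace V] (P : Finset V) (t : ℝ) :
    PreAbstractSimplicialComplex V where
  faces := {σ | σ.Nonempty ∧ σ ⊆ P ∧ ∀ x ∈ σ, ∀ y ∈ σ, dist x y ≤ t}
  isRelLowerSet_faces := fun _ h =>
    ⟨h.1, fun _ hb hne => ⟨hne, fun _ hx => h.2.1 (hb hx),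
      fun x hx y hy => h.2.2 x (hb hx) y (hb hy)⟩⟩

/-- The Vietoris–Rips filtration of a finite point set. -/
def rips {V : Type*} [PseudoMetricSpace V] (P : Finset V) :
    ℝ →o PreAbstractSimplicialComplex V where
  toFun := ripsComplex P
  monotone' := fun _ _ hst _ h => ⟨h.1, h.2.1, fun x hx y hy => (h.2.2 x hx y hy).trans hst⟩

/-- `Q` is an `ε`-perturbation of `P`: some bijection `P → Q` moves every point by at most `ε`. -/
def IsPerturbation {V : Type*} [PseudoMetricSpace V] (ε : ℝ) (P Q : Finset V) : Prop :=
  ∃ f : P ≃ Q, ∀ x : P, dist (x : V) (f x : V) ≤ ε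

end RipsStability

end

/-!
A bijection `P → Q` that moves points by at most `ε` extends to a permutation of the ambient space.
It changes diameters of simplices by at most `2ε`, so the induced bijection of chain spaces and its
inverse form a `2ε`-interleaving of the two Vietoris–Rips filtrations (`isInterleaving_rips`).

*Existence of barcodes* (`IsFiniteFiltration.exists_isBarcode`). The groups `Z_t` and `B_t` of
cycles and boundaries are two increasing filtrations of one finite vector space, and two filtrations
always have a common adapted basis (`exists_adapted_basis`). Each basis vector spans an interval
module, from its entry into the cycles to its entry into the boundaries.

*Matching* (`IsInterleaving.exists_isMatching`). A `δ`-interleaving gives matrices `φ` and `ψ` in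
terms of the two persistent bases, whose product describes a shift by `2δ`. Order the bars by the
sum of their end points. If an entry of `φ` from `I` to `J` and one of `ψ` from `J` to `I'` are
nonzero and `I'` does not precede `I`, then `J` is `δ`-close to `I` or to `I'`
(`Bar.key_lt_of_not_close`). Hence, for a set `A` of bars longer than `2δ`, a unitriangular `A × A`
matrix factors through the bars close to members of `A`, so that there are at least as many of these
as members of `A` (`IsInterleaving.card_le`). Hall's theorem turns this into an injection for
either side, and the Mendelsohn–Dulmage theorem combines the two injections into one matching
(`exists_matching_of_injective`).

*Radii* (`approxBarRadius_rips_le`). For every matched pair of bars longer than `4ε`, the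
interleaving takes a representative cycle of one bar to a `4ε`-approximate representative of the
other (`IsInterleaving.isApproxRepresentative`), and it moves the vertices by at most `ε`. Any
`2ε`-matching therefore has the required property.
-/

namespace RipsStability

/-! ### Bases adapted to two filtrations of a vector space -/

/-- A finite vector space with two filtrations `Z` and `B` has a basis adapted to both: every
`Z t` and every `B t` is spanned by the basis vectors that it contains. The functions `z` and `b`
are the indices at which a nonzero vector enters `Z` and `B`.

The basis is built greedily: each new vector lies outside the span of the previous ones and is
minimal there for the lexicographic order of the pair `(z, b)`. -/
theorem exists_adapted_basis {K C : Type*} [Field K] [AddCommGroup C] [Module K C]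
    (W : Submodule K C) (hW : (W : Set C).Finite) (Z B : ℝ → Submodule K C)
    (z b : C → WithTop ℝ) (hz : ∀ x ≠ 0, ∀ t : ℝ, x ∈ Z t ↔ z x ≤ t)
    (hb : ∀ x ≠ 0, ∀ t : ℝ, x ∈ B t ↔ b x ≤ t) (hWZ : ∀ x ∈ W, ∃ t, x ∈ Z t) :
    ∃ E : Set C, E ⊆ W ∧ LinearIndepOn K id E ∧ Submodule.span K E = W ∧
      (∀ t, ∀ x ∈ W, x ∈ Z t → x ∈ Submodule.span K (E ∩ Z t)) ∧
      (∀ t, ∀ x ∈ W, x ∈ B t → x ∈ Submodule.span K (E ∩ B t)) := by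
  have key : ∀ N : ℕ, ∃ E : Set C, E ⊆ W ∧ LinearIndepOn K id E ∧
      (∀ t, ∀ x ∈ Submodule.span K E, x ∈ Z t → x ∈ Submodule.span K (E ∩ Z t)) ∧
      (∀ t, ∀ x ∈ Submodule.span K E, x ∈ B t → x ∈ Submodule.span K (E ∩ B t)) ∧
      -- the span is an initial piece of the first filtration
      (∀ e ∈ E, ∀ x ∈ W, x ∉ Submodule.span K E → z e ≤ z x) ∧
      (Submodule.span K E = W ∨ N ≤ E.ncard) := by
    intro N
    induction N with
    | zero =>
      refine ⟨∅, by simp, linearIndepOn_empty K id, ?_, ?_, by simp, by simp⟩ <;>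
        · intro t x hx _
          simpa using hx
    | succ N ih =>
      obtain ⟨E, hEW, hli, hEZ, hEB, hini, hN⟩ := ih
      by_cases hspan : Submodule.span K E = W
      · exact ⟨E, hEW, hli, hEZ, hEB, hini, Or.inl hspan⟩
      replace hN := hN.resolve_left hspan
      have hle : Submodule.span K E ≤ W := Submodule.span_le.2 hEW
      obtain ⟨v, ⟨hvW, hvE⟩, hmin⟩ := Set.exists_min_image
        {x | x ∈ W ∧ x ∉ Submodule.span K E} (fun x => toLex (z x, b x))
        (hW.subset fun x hx => hx.1)
        (by
          obtain ⟨x, hx, hx'⟩ := SetLike.exists_of_lt (lt_of_le_of_ne hle hspan)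
          exact ⟨x, hx, hx'⟩)
      have ne_zero : ∀ x, x ∉ Submodule.span K E → x ≠ 0 := fun x hx h0 => hx (h0 ▸ zero_mem _)
      have hzmin : ∀ x ∈ W, x ∉ Submodule.span K E → z v ≤ z x := by
        intro x hx hx'
        rcases Prod.Lex.toLex_le_toLex.1 (hmin x ⟨hx, hx'⟩) with h | h
        · exact h.le
        · exact h.1.le
      have hvmem : v ∉ E := fun h => hvE (Submodule.subset_span h)
      -- the new vector enters both filtrations no later than any vector having it as leading term
      have hvZ : ∀ x ∈ W, x ∉ Submodule.span K E → ∀ t, x ∈ Z t → v ∈ Z t := by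
        intro x hx hx' t ht
        exact (hz v (ne_zero v hvE) t).2 ((hzmin x hx hx').trans ((hz x (ne_zero x hx') t).1 ht))
      have hvB : ∀ x ∈ Submodule.span K (insert v E), x ∉ Submodule.span K E →
          ∀ t, x ∈ B t → v ∈ B t := by
        intro x hx hx' t ht
        have hxW : x ∈ W := Submodule.span_le.2 (Set.insert_subset hvW hEW) hx
        obtain ⟨s, hs⟩ := hWZ v hvW
        have hvtop : z v ≠ ⊤ := ne_top_of_le_ne_top WithTop.coe_ne_top
          ((hz v (ne_zero v hvE) s).1 hs)
        obtain ⟨r, hr⟩ := WithTop.ne_top_iff_exists.1 hvtop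
        have hxr : x ∈ Z r := by
          refine Submodule.span_le.2 ?_ hx
          rintro y (rfl | hy)
          · exact (hz _ (ne_zero _ hvE) r).2 hr.ge
          · by_cases hy0 : y = 0
            · exact hy0 ▸ zero_mem _
            · exact (hz y hy0 r).2 ((hini y hy v hvW hvE).trans hr.ge)
        have hxv : z x ≤ z v := hr ▸ (hz x (ne_zero x hx') r).1 hxr
        rcases Prod.Lex.toLex_le_toLex.1 (hmin x ⟨hxW, hx'⟩) with h | h
        · exact absurd h hxv.not_gt
        · exact (hb v (ne_zero v hvE) t).2 (h.2.trans ((hb x (ne_zero x hx') t).1 ht))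
      have extend : ∀ S : Submodule K C,
          (∀ x ∈ Submodule.span K E, x ∈ S → x ∈ Submodule.span K (E ∩ S)) →
          (∀ x ∈ Submodule.span K (insert v E), x ∉ Submodule.span K E → x ∈ S → v ∈ S) →
          ∀ x ∈ Submodule.span K (insert v E), x ∈ S →
            x ∈ Submodule.span K (insert v E ∩ S) := by
        intro S h1 h2 x hx hxS
        have hmono : Submodule.span K (E ∩ S) ≤ Submodule.span K (insert v E ∩ S) :=
          Submodule.span_mono (Set.inter_subset_inter_left _ (Set.subset_insert _ _))
        by_cases hxE : x ∈ Submodule.span K E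
        · exact hmono (h1 x hxE hxS)
        · have hvS := h2 x hx hxE hxS
          obtain ⟨c, y, hy, rfl⟩ := Submodule.mem_span_insert.1 hx
          have hyS : y ∈ S := by simpa using S.sub_mem hxS (S.smul_mem c hvS)
          exact add_mem (Submodule.smul_mem _ c
            (Submodule.subset_span ⟨Set.mem_insert _ _, hvS⟩)) (hmono (h1 y hy hyS))
      have hEfin : E.Finite := hW.subset hEW
      refine ⟨insert v E, Set.insert_subset hvW hEW, hli.id_insert hvE,
        fun t => extend _ (hEZ t) fun x hx hx' ht =>
          hvZ x (Submodule.span_le.2 (Set.insert_subset hvW hEW) hx) hx' t ht,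
        fun t => extend _ (hEB t) fun x hx hx' ht => hvB x hx hx' t ht, ?_, ?_⟩
      · rintro e he x hx hx'
        have hxE : x ∉ Submodule.span K E :=
          fun h => hx' (Submodule.span_mono (Set.subset_insert _ _) h)
        rcases he with rfl | he
        · exact hzmin x hx hxE
        · exact hini e he x hx hxE
      · right
        rw [Set.ncard_insert_of_notMem hvmem hEfin]
        omega
  obtain ⟨E, hEW, hli, hEZ, hEB, -, h⟩ := key ((W : Set C).ncard + 1)
  have hspan : Submodule.span K E = W := h.resolve_right fun h => by
    have := Set.ncard_le_ncard hEW hW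
    omega
  rw [hspan] at hEZ hEB
  exact ⟨E, hEW, hli, hspan, hEZ, hEB⟩

open Classical in
/-- The first index of the finite set `T` at which `x` belongs to the filtration `Z`, or `⊤`. -/
noncomputable def entry {K C : Type*} [Field K] [AddCommGroup C] [Module K C] (T : Finset ℝ)
    (Z : ℝ → Submodule K C) (x : C) : WithTop ℝ :=
  (T.filter fun s => x ∈ Z s).min

/-- If the filtration `Z` changes only at the indices in `T`, then `entry T Z x` is the first
index at which a nonzero `x` belongs to `Z`. The zero vector has no first index. -/
theorem mem_iff_entry_le {K C : Type*} [Field K] [AddCommGroup C] [Module K C] {T : Finset ℝ}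
    {Z : ℝ → Submodule K C} (hmono : Monotone Z)
    (hT : ∀ t, Z t = ⊥ ∨ ∃ s ∈ T, s ≤ t ∧ Z s = Z t) {x : C} (hx : x ≠ 0) (t : ℝ) :
    x ∈ Z t ↔ entry T Z x ≤ t := by
  classical
  constructor
  · intro h
    rcases hT t with h0 | ⟨s, hs, hst, hZ⟩
    · exact absurd ((Submodule.mem_bot K).1 (h0 ▸ h)) hx
    · exact (Finset.min_le (Finset.mem_filter.2 ⟨hs, hZ ▸ h⟩)).trans (WithTop.coe_le_coe.2 hst)
  · intro h
    obtain ⟨r, hr⟩ := WithTop.ne_top_iff_exists.1 (ne_top_of_le_ne_top WithTop.coe_ne_top h)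
    have hmem := Finset.mem_of_min (s := T.filter fun s => x ∈ Z s) (a := r) (by
      rw [hr]; unfold entry; congr)
    rw [← hr, WithTop.coe_le_coe] at h
    exact hmono h (Finset.mem_filter.1 hmem).2

theorem sum_eq_sum_subtype_of_ne_zero {ι M : Type*} [Fintype ι] [AddCommMonoid M]
    (A : ι → Prop) [Fintype {i // A i}] {f : ι → M} (hf : ∀ i, f i ≠ 0 → A i) :
    ∑ i, f i = ∑ i : {i // A i}, f i := by
  classical
  rw [← Finset.sum_filter_of_ne fun i _ hi => hf i hi]
  exact Finset.sum_subtype _ (by simp) f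

/-! ### Cycles, boundaries and persistent bases -/

variable {V V' : Type*}

theorem homologyClass_eq_zero_iff {K : PreAbstractSimplicialComplex V} {p : ℕ} {x : Chain V} :
    homologyClass K p x = 0 ↔ x ∈ boundaries K p :=
  Submodule.Quotient.mk_eq_zero _

theorem homologyClass_eq_iff {K : PreAbstractSimplicialComplex V} {p : ℕ} {x y : Chain V} :
    homologyClass K p x = homologyClass K p y ↔ x - y ∈ boundaries K p :=
  Submodule.Quotient.eq _

theorem chains_mono {K L : PreAbstractSimplicialComplex V} (h : K ≤ L) (p : ℕ) :
    chains K p ≤ chains L p :=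
  Finsupp.supported_mono fun _ hσ => ⟨h hσ.1, hσ.2⟩

theorem cycles_mono {K L : PreAbstractSimplicialComplex V} (h : K ≤ L) (p : ℕ) :
    cycles K p ≤ cycles L p :=
  inf_le_inf_right _ (chains_mono h p)

theorem boundaries_mono {K L : PreAbstractSimplicialComplex V} (h : K ≤ L) (p : ℕ) :
    boundaries K p ≤ boundaries L p :=
  Submodule.map_mono (chains_mono h (p + 1))

namespace IsPersistentBasis

variable {F : ℝ →o PreAbstractSimplicialComplex V} {p m : ℕ} {X : Fin m → Bar}
  {ζ : Fin m → Chain V}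

/-- At the index `t`, every cycle is homologous to a combination of the alive basis cycles. -/
theorem exists_expansion (h : IsPersistentBasis F p X ζ) {t : ℝ} {x : Chain V}
    (hx : x ∈ cycles (F t) p) :
    ∃ c : Fin m → ZMod 2, (∀ j, c j ≠ 0 → (X j).Alive t) ∧
      x - ∑ j, c j • ζ j ∈ boundaries (F t) p := by
  classical
  have hmem : homologyClass (F t) p x ∈ homology (F t) p := Submodule.mem_map_of_mem hx
  rw [← h.span t] at hmem
  obtain ⟨c, hc⟩ := (Submodule.mem_span_range_iff_exists_fun (ZMod 2)).1 hmem
  refine ⟨fun j => if hj : (X j).Alive t then c ⟨j, hj⟩ else 0, fun j hj => ?_, ?_⟩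
  · by_contra hn
    simp [hn] at hj
  · rw [← homologyClass_eq_iff, ← hc, map_sum,
      sum_eq_sum_subtype_of_ne_zero (fun j => (X j).Alive t)]
    · refine Finset.sum_congr rfl fun j _ => ?_
      simp [j.2]
    · intro j hj
      by_contra hn
      simp [hn] at hj

/-- A combination of basis cycles born by the time `t` bounds at `t` only if no alive cycle
occurs in it. -/
theorem coeff_eq_zero (h : IsPersistentBasis F p X ζ) {t : ℝ} {c : Fin m → ZMod 2}
    (hc : ∀ j, c j ≠ 0 → (X j).birth ≤ t) (hmem : ∑ j, c j • ζ j ∈ boundaries (F t) p)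
    (j : Fin m) (hj : (X j).Alive t) : c j = 0 := by
  classical
  rw [← homologyClass_eq_zero_iff, map_sum,
    sum_eq_sum_subtype_of_ne_zero (fun j => (X j).Alive t)] at hmem
  · simp only [map_smul] at hmem
    exact Fintype.linearIndependent_iff.1 (h.indep t) (fun j => c j) hmem ⟨j, hj⟩
  · intro i hi
    have hci : c i ≠ 0 := fun h0 => hi (by simp [h0])
    refine ⟨hc i hci, ?_⟩
    by_contra hd
    exact hi (by rw [map_smul, h.dead i t (not_lt.1 hd), smul_zero])

/-- The basis cycle of a bar bounds exactly from the right end point of the bar on. -/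
theorem mem_boundaries_iff (h : IsPersistentBasis F p X ζ) (j : Fin m) (t : ℝ) :
    ζ j ∈ boundaries (F t) p ↔ (X j).death ≤ t := by
  refine ⟨fun ht => ?_, fun ht => homologyClass_eq_zero_iff.1 (h.dead j t ht)⟩
  by_contra hd
  -- a cycle that bounds before its birth still bounds at its birth
  have hmax : (X j).Alive (max t (X j).birth) := by
    refine ⟨le_max_right _ _, ?_⟩
    rcases max_choice t (X j).birth with hm | hm <;> rw [hm]
    · exact not_le.1 hd
    · exact (X j).birth_lt_death
  exact (h.indep (max t (X j).birth)).ne_zero ⟨j, hmax⟩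
    (homologyClass_eq_zero_iff.2 (boundaries_mono (F.monotone (le_max_left _ _)) p ht))

/-- As long as its bar is alive, a basis cycle is not homologous to any older cycle. -/
theorem sub_notMem_boundaries (h : IsPersistentBasis F p X ζ) {j : Fin m} {s t : ℝ}
    (hj : (X j).Alive t) (hs : s < (X j).birth) {w : Chain V} (hw : w ∈ cycles (F s) p) :
    ζ j - w ∉ boundaries (F t) p := by
  classical
  intro hmem
  obtain ⟨c, hc, hcw⟩ := h.exists_expansion hw
  have hst : s ≤ t := hs.le.trans hj.1
  have hsum : ∑ i, (Pi.single (M := fun _ => ZMod 2) j 1 - c) i • ζ i ∈ boundaries (F t) p := by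
    have heq : ∑ i, (Pi.single (M := fun _ => ZMod 2) j 1 - c) i • ζ i =
        (ζ j - w) + (w - ∑ i, c i • ζ i) := by
      simp [sub_smul, Finset.sum_sub_distrib, Pi.single_apply, ite_smul]
    rw [heq]
    exact add_mem hmem (boundaries_mono (F.monotone hst) p hcw)
  have hcj : c j = 0 := by
    by_contra hne
    exact absurd (hc j hne).1 (not_le.2 hs)
  have := h.coeff_eq_zero (fun i hi => ?_) hsum j hj
  · simp [hcj] at this
  · by_cases hij : i = j
    · exact hij ▸ hj.1
    · refine (hc i fun h0 => hi ?_).1.trans hst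
      simp [hij, h0]

/-- The left end point of a bar is the first index at which its basis cycle is a cycle. -/
theorem mem_cycles_iff (h : IsPersistentBasis F p X ζ) (j : Fin m) (t : ℝ) :
    ζ j ∈ cycles (F t) p ↔ (X j).birth ≤ t := by
  refine ⟨fun ht => ?_, fun ht => cycles_mono (F.monotone ht) p (h.cycle j)⟩
  by_contra hn
  refine h.sub_notMem_boundaries (t := (X j).birth) ⟨le_rfl, (X j).birth_lt_death⟩
    (not_le.1 hn) ht ?_
  rw [sub_self]
  exact zero_mem _

end IsPersistentBasis

/-! ### Existence of barcodes -/

/-- The filtration `F` consists of finite complexes, is eventually empty towards `-∞`, and changes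
only at the indices in the finite set `T`, where it is continuous from the right. -/
structure IsFiniteFiltration (F : ℝ →o PreAbstractSimplicialComplex V) (T : Finset ℝ) : Prop where
  /-- every complex is empty or equal to the complex at the last preceding index in `T` -/
  step : ∀ t, F t = ⊥ ∨ ∃ s ∈ T, s ≤ t ∧ F s = F t
  /-- every complex is finite -/
  finite : ∀ t, (F t).faces.Finite

theorem chains_bot (p : ℕ) : chains (⊥ : PreAbstractSimplicialComplex V) p = ⊥ := by
  have : {σ : Finset V | σ ∈ (⊥ : PreAbstractSimplicialComplex V) ∧ σ.card = p + 1} = ∅ :=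
    Set.eq_empty_of_forall_notMem fun σ hσ => hσ.1
  rw [chains, this, Finsupp.supported_empty]

namespace IsFiniteFiltration

variable {F : ℝ →o PreAbstractSimplicialComplex V} {T : Finset ℝ}

theorem cycles_step (h : IsFiniteFiltration F T) (p : ℕ) (t : ℝ) :
    cycles (F t) p = ⊥ ∨ ∃ s ∈ T, s ≤ t ∧ cycles (F s) p = cycles (F t) p := by
  rcases h.step t with h0 | ⟨s, hs, hst, he⟩
  · left
    rw [h0, cycles, chains_bot, bot_inf_eq]
  · exact Or.inr ⟨s, hs, hst, by rw [he]⟩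

theorem boundaries_step (h : IsFiniteFiltration F T) (p : ℕ) (t : ℝ) :
    boundaries (F t) p = ⊥ ∨ ∃ s ∈ T, s ≤ t ∧ boundaries (F s) p = boundaries (F t) p := by
  rcases h.step t with h0 | ⟨s, hs, hst, he⟩
  · left
    rw [h0, boundaries, chains_bot, Submodule.map_bot]
  · exact Or.inr ⟨s, hs, hst, by rw [he]⟩

theorem mem_cycles_iff (h : IsFiniteFiltration F T) {p : ℕ} {x : Chain V} (hx : x ≠ 0) (t : ℝ) :
    x ∈ cycles (F t) p ↔ entry T (fun s => cycles (F s) p) x ≤ t :=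
  mem_iff_entry_le (fun _ _ hst => cycles_mono (F.monotone hst) p) (h.cycles_step p) hx t

theorem mem_boundaries_iff (h : IsFiniteFiltration F T) {p : ℕ} {x : Chain V} (hx : x ≠ 0)
    (t : ℝ) : x ∈ boundaries (F t) p ↔ entry T (fun s => boundaries (F s) p) x ≤ t :=
  mem_iff_entry_le (fun _ _ hst => boundaries_mono (F.monotone hst) p) (h.boundaries_step p) hx t

theorem finite_iSup_cycles (h : IsFiniteFiltration F T) (p : ℕ) :
    ((⨆ t, cycles (F t) p : Submodule (ZMod 2) (Chain V)) : Set (Chain V)).Finite := by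
  have hS : (⋃ s ∈ T, (F s).faces).Finite := T.finite_toSet.biUnion fun s _ => h.finite s
  set S := ⋃ s ∈ T, (F s).faces
  have hle : (⨆ t, cycles (F t) p) ≤ Finsupp.supported (ZMod 2) (ZMod 2) S := by
    refine iSup_le fun t => inf_le_left.trans (Finsupp.supported_mono fun σ hσ => ?_)
    rcases h.step t with h0 | ⟨s, hs, -, he⟩
    · rw [h0] at hσ
      exact hσ.1.elim
    · exact Set.mem_biUnion hs (he ▸ hσ.1 : σ ∈ F s)
  have := hS.to_subtype
  have : Finite (S →₀ ZMod 2) := Finite.of_injective _ DFunLike.coe_injective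
  have : Finite (Finsupp.supported (ZMod 2) (ZMod 2) S) :=
    Finite.of_equiv _ (Finsupp.supportedEquivFinsupp (M := ZMod 2) (R := ZMod 2) S).symm.toEquiv
  exact Set.Finite.subset (Set.toFinite _) hle

/-- A finite filtration has a barcode in every degree: in a basis adapted to the filtrations by
cycles and by boundaries, every vector spans an interval module, from its entry into the cycles to
its entry into the boundaries. -/
theorem exists_isBarcode (h : IsFiniteFiltration F T) (p : ℕ) :
    ∃ (m : ℕ) (X : Fin m → Bar), IsBarcode F p X := by
  classical
  set z := entry T (fun s => cycles (F s) p) with hz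
  set b := entry T (fun s => boundaries (F s) p)
  set W : Submodule (ZMod 2) (Chain V) := ⨆ t, cycles (F t) p
  have hWmem : ∀ x, x ∈ W ↔ ∃ t, x ∈ cycles (F t) p := fun x =>
    Submodule.mem_iSup_of_directed _
      (Monotone.directed_le fun _ _ hst => cycles_mono (F.monotone hst) p)
  obtain ⟨E, hEW, hli, -, hEZ, hEB⟩ := exists_adapted_basis W (h.finite_iSup_cycles p)
    (fun s => cycles (F s) p) (fun s => boundaries (F s) p) z b
    (fun x hx t => h.mem_cycles_iff hx t) (fun x hx t => h.mem_boundaries_iff hx t)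
    (fun x hx => (hWmem x).1 hx)
  have hE0 : ∀ e ∈ E, e ≠ 0 := fun e he => hli.ne_zero he
  have hEfin : {e | e ∈ E ∧ z e < b e}.Finite :=
    (h.finite_iSup_cycles p).subset fun e he => hEW he.1
  have := hEfin.fintype
  set f : Fin (Fintype.card {e | e ∈ E ∧ z e < b e}) ≃ {e | e ∈ E ∧ z e < b e} :=
    (Fintype.equivFin _).symm
  have hbirth : ∀ e ∈ E, ∃ r : ℝ, (r : WithTop ℝ) = z e := by
    intro e he
    obtain ⟨t, ht⟩ := (hWmem e).1 (hEW he)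
    exact WithTop.ne_top_iff_exists.1 (ne_top_of_le_ne_top WithTop.coe_ne_top
      ((h.mem_cycles_iff (hE0 e he) t).1 ht))
  choose! r hr using hbirth
  have hfE : ∀ j, (f j : Chain V) ∈ E := fun j => (f j).2.1
  let X : Fin (Fintype.card {e | e ∈ E ∧ z e < b e}) → Bar := fun j =>
    { birth := r (f j)
      death := b (f j)
      birth_lt_death := by rw [hr _ (hfE j)]; exact (f j).2.2 }
  have hcyc : ∀ e ∈ E, ∀ t, e ∈ cycles (F t) p ↔ r e ≤ t := fun e he t => by
    refine (h.mem_cycles_iff (hE0 e he) t).trans ?_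
    rw [← hz, ← hr e he]
    exact WithTop.coe_le_coe
  have hbd : ∀ e ∈ E, ∀ t, e ∈ boundaries (F t) p ↔ b e ≤ t := fun e he t =>
    h.mem_boundaries_iff (hE0 e he) t
  refine ⟨_, X, fun j => f j, fun j => (hcyc _ (hfE j) _).2 le_rfl,
    fun j t ht => homologyClass_eq_zero_iff.2 ((hbd _ (hfE j) t).2 ht), fun t => ?_, fun t => ?_⟩
  · rw [Fintype.linearIndependent_iff]
    intro c hc i
    simp only [← map_smul, ← map_sum, homologyClass_eq_zero_iff] at hc
    have hmem := hEB t _ (sum_mem fun j _ => W.smul_mem _ (hEW (hfE j.1))) hc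
    -- the span of the basis vectors that bound is independent of the remaining ones
    have hdisj : Disjoint (Submodule.span (ZMod 2) (E ∩ boundaries (F t) p))
        (Submodule.span (ZMod 2) (Set.range fun j : {j // (X j).Alive t} => (f j : Chain V))) := by
      refine ((linearIndepOn_id_union_iff ?_).1 (hli.mono (Set.union_subset
        Set.inter_subset_left ?_))).2.2
      · rw [Set.disjoint_right]
        rintro _ ⟨j, rfl⟩ hj
        exact absurd ((hbd _ (hfE j.1) t).1 hj.2) (not_le.2 j.2.2)
      · rintro _ ⟨j, rfl⟩
        exact hfE j.1
    have hzero := Submodule.disjoint_def.1 hdisj _ hmem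
      (sum_mem fun j _ => Submodule.smul_mem _ _ (Submodule.subset_span ⟨j, rfl⟩))
    have hind : LinearIndependent (ZMod 2) (fun j : {j // (X j).Alive t} => (f j : Chain V)) :=
      LinearIndependent.comp (hli : LinearIndependent (ZMod 2) fun e : E => id (e : Chain V))
        (fun j : {j // (X j).Alive t} => (⟨f j, hfE j.1⟩ : E)) fun j j' hjj' =>
          by
          have hval := Subtype.ext_iff.1 hjj'
          exact Subtype.ext (f.injective (Subtype.ext hval))
    exact Fintype.linearIndependent_iff.1 hind c hzero i
  · apply le_antisymm
    · rw [Submodule.span_le]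
      rintro _ ⟨j, rfl⟩
      exact Submodule.mem_map_of_mem ((hcyc _ (hfE j.1) t).2 j.2.1)
    · rw [homology, Submodule.map_le_iff_le_comap]
      intro x hx
      refine Submodule.span_le.2 ?_ (hEZ t x ((hWmem x).2 ⟨t, hx⟩) hx)
      rintro e ⟨heE, he⟩
      by_cases het : e ∈ boundaries (F t) p
      · rw [SetLike.mem_coe, Submodule.mem_comap, homologyClass_eq_zero_iff.2 het]
        exact zero_mem _
      · have hlt : (t : WithTop ℝ) < b e := not_le.1 fun hle => het ((hbd e heE t).2 hle)
        have hrt := (hcyc e heE t).1 he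
        have hzb : z e < b e := by
          rw [← hr e heE]
          exact (WithTop.coe_le_coe.2 hrt).trans_lt hlt
        refine Submodule.subset_span ⟨⟨f.symm ⟨e, heE, hzb⟩, ?_, ?_⟩, ?_⟩
        · simpa [X] using hrt
        · simpa [X] using hlt
        · simp

end IsFiniteFiltration

/-! ### Interleavings and transfer of representative cycles -/

/-- The two bars have left end points and right end points at distance at most `δ`. -/
def Bar.Close (δ : ℝ) (I J : Bar) : Prop :=
  |I.birth - J.birth| ≤ δ ∧
    I.death ≤ J.death + (δ : WithTop ℝ) ∧ J.death ≤ I.death + (δ : WithTop ℝ)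

theorem Bar.Close.symm {δ : ℝ} {I J : Bar} (h : I.Close δ J) : J.Close δ I :=
  ⟨by rw [abs_sub_comm]; exact h.1, h.2.2, h.2.1⟩

/-- The linear bijection `a` of the chain spaces is, together with its inverse, a `δ`-interleaving
of the two filtrations in degree `p`: both maps take cycles to cycles and boundaries to boundaries
at the cost of increasing the index by `δ`. -/
structure IsInterleaving (δ : ℝ) (F : ℝ →o PreAbstractSimplicialComplex V)
    (G : ℝ →o PreAbstractSimplicialComplex V') (p : ℕ)
    (a : Chain V ≃ₗ[ZMod 2] Chain V') : Prop where
  /-- `a` maps cycles to cycles -/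
  map_cycles : ∀ t, ∀ x ∈ cycles (F t) p, a x ∈ cycles (G (t + δ)) p
  /-- `a` maps boundaries to boundaries -/
  map_boundaries : ∀ t, ∀ x ∈ boundaries (F t) p, a x ∈ boundaries (G (t + δ)) p
  /-- the inverse of `a` maps cycles to cycles -/
  symm_map_cycles : ∀ t, ∀ x ∈ cycles (G t) p, a.symm x ∈ cycles (F (t + δ)) p
  /-- the inverse of `a` maps boundaries to boundaries -/
  symm_map_boundaries : ∀ t, ∀ x ∈ boundaries (G t) p, a.symm x ∈ boundaries (F (t + δ)) p

variable {δ : ℝ} {F : ℝ →o PreAbstractSimplicialComplex V}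
  {G : ℝ →o PreAbstractSimplicialComplex V'} {p : ℕ} {a : Chain V ≃ₗ[ZMod 2] Chain V'}

theorem IsInterleaving.symm (h : IsInterleaving δ F G p a) : IsInterleaving δ G F p a.symm :=
  ⟨h.symm_map_cycles, h.symm_map_boundaries, h.map_cycles, h.map_boundaries⟩

/-- An interleaving takes a representative cycle of a long bar to an approximate representative of
every bar that is close to it. -/
theorem IsInterleaving.isApproxRepresentative (h : IsInterleaving δ F G p a)
    {T : Finset ℝ} (hF : IsFiniteFiltration F T) {I J : Bar} (hIJ : I.Close δ J)
    (hJ : J.LongerThan (2 * δ)) {ζ : Chain V'} (hζ : IsRepresentative G p J ζ) :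
    IsApproxRepresentative F p (2 * δ) I (a.symm ζ) := by
  obtain ⟨m, X, z, hX, j, rfl, rfl⟩ := hζ
  have hcyc := hX.mem_cycles_iff j
  have hbd := hX.mem_boundaries_iff j
  set J := X j
  obtain ⟨hb, hd₁, hd₂⟩ := hIJ
  rw [abs_le] at hb
  have hne : a.symm (z j) ≠ 0 := by
    rw [Ne, LinearEquiv.map_eq_zero_iff]
    intro h0
    have h1 : z j ∈ cycles (G (J.birth - 1)) p := h0 ▸ zero_mem _
    linarith [(hcyc _).1 h1]
  have hcyc' := hF.mem_cycles_iff (p := p) hne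
  have hbd' := hF.mem_boundaries_iff (p := p) hne
  have hle := (hcyc' _).1 (h.symm_map_cycles _ _ ((hcyc J.birth).2 le_rfl))
  obtain ⟨b', hb'⟩ := WithTop.ne_top_iff_exists.1 (ne_top_of_le_ne_top WithTop.coe_ne_top hle)
  rw [← hb', WithTop.coe_le_coe] at hle
  simp only [← hb', WithTop.coe_le_coe] at hcyc'
  have hge : J.birth ≤ b' + δ := (hcyc _).1 (by
    simpa using h.map_cycles _ _ ((hcyc' b').2 le_rfl))
  set d' := entry T (fun s => boundaries (F s) p) (a.symm (z j))
  have hdle : d' ≤ J.death + (δ : WithTop ℝ) := by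
    rcases hJd : J.death with _ | d
    · exact le_top
    · exact (hbd' (d + δ)).1 (h.symm_map_boundaries _ _ ((hbd d).2 hJd.le))
  have hdge : J.death ≤ d' + (δ : WithTop ℝ) := by
    rcases hd'd : d' with _ | d
    · exact le_top
    · refine (hbd (d + δ)).1 ?_
      simpa using h.map_boundaries _ _ ((hbd' d).2 hd'd.le)
  have hlt : (b' : WithTop ℝ) < d' := by
    unfold Bar.LongerThan at hJ
    rcases hd'd : d' with _ | d
    · exact WithTop.coe_lt_top _
    · rw [hd'd] at hdge
      have hlt := hJ.trans_le hdge
      change ((J.birth + 2 * δ : ℝ) : WithTop ℝ) < ((d + δ : ℝ) : WithTop ℝ) at hlt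
      rw [WithTop.coe_lt_coe] at hlt
      exact WithTop.coe_lt_coe.2 (by linarith)
  have htwo : ∀ d : WithTop ℝ, d + ((2 * δ : ℝ) : WithTop ℝ) =
      d + (δ : WithTop ℝ) + (δ : WithTop ℝ) := fun d => by
    rw [add_assoc, two_mul, WithTop.coe_add]
  refine ⟨b', d', ?_, ?_, ?_, hlt, hcyc', fun s hs w hw hew => ?_, fun s _ => ?_⟩
  · rw [abs_le]
    constructor <;> linarith
  · rw [htwo]
    exact hdle.trans (add_le_add_left hd₂ _)
  · rw [htwo]
    exact hd₁.trans (add_le_add_left hdge _)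
  · -- a homologous older cycle would be taken to a cycle that is older than the bar of `z j`
    refine hX.sub_notMem_boundaries (j := j) (s := s + δ) (t := b' + δ) ⟨hge, ?_⟩
      (by change s + δ < J.birth; linarith) (h.map_cycles s w hw) ?_
    · refine lt_of_le_of_lt (WithTop.coe_le_coe.2 ?_) hJ
      linarith
    · simpa using h.map_boundaries _ _ (homologyClass_eq_iff.1 hew)
  · rw [homologyClass_eq_zero_iff]
    exact hbd' s

/-! ### Stability of barcodes -/

/-- Bars ordered by the sum of their end points; infinite bars come last and are ordered by their
left end points. -/
def Bar.key (I : Bar) : WithTop ℝ ×ₗ ℝ := toLex (I.death + (I.birth : WithTop ℝ), I.birth)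

theorem Bar.key_lt_of_lt {I I' : Bar} (hb : I'.birth < I.birth) (hd : I'.death ≤ I.death) :
    I'.key < I.key := by
  refine Prod.Lex.toLex_lt_toLex.2 ?_
  rcases hd₁ : I.death with _ | d <;> rcases hd₂ : I'.death with _ | d'
  · exact Or.inr ⟨rfl, hb⟩
  · exact Or.inl (WithTop.coe_lt_top _)
  · rw [hd₁, hd₂] at hd
    exact absurd hd (not_le.2 (WithTop.coe_lt_top _))
  · rw [hd₁, hd₂] at hd
    have hd : d' ≤ d := WithTop.coe_le_coe.1 hd
    exact Or.inl (WithTop.coe_lt_coe.2 (by linarith) : ((d' + I'.birth : ℝ) : WithTop ℝ) < _)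

/-- If there are nonzero morphisms from the interval module of `I` to that of `J` and on to that of
`I'`, each of degree `δ`, and `J` is close to neither `I` nor `I'`, then `I'` precedes `I`. -/
theorem Bar.key_lt_of_not_close {δ : ℝ} (hδ : 0 ≤ δ) {I J I' : Bar}
    (hb₁ : J.birth ≤ I.birth + δ) (hd₁ : J.death ≤ I.death + (δ : WithTop ℝ))
    (hb₂ : I'.birth ≤ J.birth + δ) (hd₂ : I'.death ≤ J.death + (δ : WithTop ℝ))
    (hI : ¬ I.Close δ J) (hI' : ¬ I'.Close δ J) : I'.key < I.key := by
  unfold Bar.Close at hI hI'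
  rw [abs_le] at hI hI'
  refine Prod.Lex.toLex_lt_toLex.2 ?_
  simp only
  generalize I.death = d at *
  generalize J.death = e at *
  generalize I'.death = d' at *
  have top_add : (⊤ : WithTop ℝ) + (δ : WithTop ℝ) = ⊤ := rfl
  induction d with
  | top =>
    induction d' with
    | top =>
      induction e with
      | top =>
        simp only [top_add, le_refl, and_true, and_self, not_and_or, not_le] at *
        right
        refine ⟨rfl, ?_⟩
        rcases hI with h | h <;> rcases hI' with h' | h' <;> linarith
      | coe e => exact absurd hd₂ (not_le.2 (WithTop.coe_lt_top _))
    | coe d' => exact Or.inl (WithTop.coe_lt_top _)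
  | coe d =>
    induction e with
    | top => exact absurd hd₁ (not_le.2 (WithTop.coe_lt_top _))
    | coe e =>
      induction d' with
      | top => exact absurd hd₂ (not_le.2 (WithTop.coe_lt_top _))
      | coe d' =>
        left
        simp only [← WithTop.coe_add, WithTop.coe_le_coe, WithTop.coe_lt_coe, not_and_or,
          not_le] at *
        rcases hI with (h | h) | h | h <;> rcases hI' with (h' | h') | h' | h' <;> linarith

/-- The interleaving maps a basis cycle to a combination of basis cycles whose bars are born at
most `δ` later and die at most `δ` later. -/
theorem IsInterleaving.exists_matrix (h : IsInterleaving δ F G p a) {m k : ℕ} {X : Fin m → Bar}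
    {Y : Fin k → Bar} {ζ : Fin m → Chain V} {η : Fin k → Chain V'}
    (hX : IsPersistentBasis F p X ζ) (hY : IsPersistentBasis G p Y η) :
    ∃ φ : Fin m → Fin k → ZMod 2,
      (∀ i, a (ζ i) - ∑ j, φ i j • η j ∈ boundaries (G ((X i).birth + δ)) p) ∧
      ∀ i j, φ i j ≠ 0 → (Y j).birth ≤ (X i).birth + δ ∧
        (Y j).death ≤ (X i).death + (δ : WithTop ℝ) := by
  have hexp := fun i => hY.exists_expansion (h.map_cycles _ _ (hX.cycle i))
  choose φ hφ hmem using hexp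
  refine ⟨φ, hmem, fun i j hij => ⟨(hφ i j hij).1, ?_⟩⟩
  by_contra hd
  obtain ⟨d, hdd⟩ : ∃ d : ℝ, (d : WithTop ℝ) = (X i).death := WithTop.ne_top_iff_exists.1
    fun htop => hd (by rw [htop]; exact le_top)
  have hbd : (X i).birth + δ ≤ d + δ := by
    have := (X i).birth_lt_death
    rw [← hdd, WithTop.coe_lt_coe] at this
    linarith
  -- the image of the basis cycle bounds at `d + δ`, where the bar of `η j` would still be alive
  refine hij (hY.coeff_eq_zero (t := d + δ) (fun j hj => (hφ i j hj).1.trans hbd) ?_ j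
    ⟨(hφ i j hij).1.trans hbd, ?_⟩)
  · have h1 := h.map_boundaries d _ ((hX.mem_boundaries_iff i d).2 hdd.ge)
    have h2 := boundaries_mono (G.monotone hbd) p (hmem i)
    simpa using sub_mem h1 h2
  · rw [← hdd] at hd
    exact not_le.1 hd

/-- The matrix of a `2δ`-shift that factors through an interleaving is unitriangular on the bars
longer than `2δ`. -/
theorem IsInterleaving.matrix_mul_apply (h : IsInterleaving δ F G p a) (hδ : 0 ≤ δ)
    {m k : ℕ} {X : Fin m → Bar}
    {Y : Fin k → Bar} {ζ : Fin m → Chain V} {η : Fin k → Chain V'}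
    (hX : IsPersistentBasis F p X ζ)
    {φ : Fin m → Fin k → ZMod 2} {ψ : Fin k → Fin m → ZMod 2}
    (hφ : ∀ i, a (ζ i) - ∑ j, φ i j • η j ∈ boundaries (G ((X i).birth + δ)) p)
    (hφb : ∀ i j, φ i j ≠ 0 → (Y j).birth ≤ (X i).birth + δ)
    (hψ : ∀ j, a.symm (η j) - ∑ i, ψ j i • ζ i ∈ boundaries (F ((Y j).birth + δ)) p)
    (hψb : ∀ j i, ψ j i ≠ 0 → (X i).birth ≤ (Y j).birth + δ)
    {i i' : Fin m} (hi : (X i).LongerThan (2 * δ)) (hi' : (X i').LongerThan (2 * δ))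
    (hkey : ¬ (X i').key < (X i).key) :
    ∑ j, φ i j * ψ j i' = if i = i' then 1 else 0 := by
  classical
  set t := (X i).birth + 2 * δ with ht
  set c : Fin m → ZMod 2 := fun i' => Pi.single (M := fun _ => ZMod 2) i 1 i' -
    ∑ j, φ i j * ψ j i' with hc
  have hbirth : ∀ i', ∑ j, φ i j * ψ j i' ≠ 0 → (X i').birth ≤ t := by
    intro i' hne
    obtain ⟨j, -, hj⟩ := Finset.exists_ne_zero_of_sum_ne_zero hne
    linarith [hφb i j (left_ne_zero_of_mul hj), hψb j i' (right_ne_zero_of_mul hj)]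
  have hcb : ∀ i', c i' ≠ 0 → (X i').birth ≤ t := by
    intro i' hne
    by_cases hii : i' = i
    · rw [hii]; linarith
    · refine hbirth i' fun h0 => hne ?_
      simp [hc, h0, hii]
  have hsum : ∑ i', c i' • ζ i' ∈ boundaries (F t) p := by
    have heq : ∑ i', c i' • ζ i' = a.symm (a (ζ i) - ∑ j, φ i j • η j) +
        ∑ j, φ i j • (a.symm (η j) - ∑ i', ψ j i' • ζ i') := by
      have hcomm : ∑ i', (∑ j, φ i j * ψ j i') • ζ i' = ∑ j, φ i j • ∑ i', ψ j i' • ζ i' := by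
        simp only [Finset.sum_smul, Finset.smul_sum, mul_smul]
        exact Finset.sum_comm
      simp only [hc, sub_smul, Finset.sum_sub_distrib, hcomm, smul_sub, map_sub, map_sum,
        map_smul, LinearEquiv.symm_apply_apply]
      simp [Pi.single_apply, ite_smul]
    rw [heq]
    refine add_mem (boundaries_mono (F.monotone (by linarith)) p
      (h.symm_map_boundaries _ _ (hφ i))) (sum_mem fun j _ => ?_)
    by_cases hj : φ i j = 0
    · rw [hj, zero_smul]
      exact zero_mem _
    · exact Submodule.smul_mem _ _ (boundaries_mono (F.monotone (by linarith [hφb i j hj])) p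
        (hψ j))
  have hzero := hX.coeff_eq_zero hcb hsum i'
  by_cases halive : (X i').Alive t
  · have := hzero halive
    rw [hc] at this
    rw [← sub_eq_zero.1 this, Pi.single_apply]
    simp [eq_comm]
  · have hne : i ≠ i' := by
      rintro rfl
      exact halive ⟨by linarith, hi⟩
    rw [if_neg hne]
    by_contra hsne
    -- a bar that is born but dead at `t` precedes the bar of `i`, which is alive at `t`
    have hb := hbirth i' hsne
    have hd : (X i').death ≤ t := not_lt.1 fun hlt => halive ⟨hb, hlt⟩
    refine hkey (Bar.key_lt_of_lt ?_ (hd.trans hi.le))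
    have := WithTop.coe_lt_coe.1 (hi'.trans_le hd)
    linarith

/-- Any set of bars of `F` longer than `2δ` is no larger than the set of bars of `G` that are close
to one of them. -/
theorem IsInterleaving.card_le (h : IsInterleaving δ F G p a) (hδ : 0 ≤ δ)
    {m k : ℕ} {X : Fin m → Bar} {Y : Fin k → Bar}
    (hX : IsBarcode F p X) (hY : IsBarcode G p Y) (A : Finset (Fin m)) (N : Finset (Fin k))
    (hA : ∀ i ∈ A, (X i).LongerThan (2 * δ)) (hN : ∀ i ∈ A, ∀ j, (X i).Close δ (Y j) → j ∈ N) :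
    A.card ≤ N.card := by
  classical
  obtain ⟨ζ, hX⟩ := hX
  obtain ⟨η, hY⟩ := hY
  obtain ⟨φ, hφ, hφ'⟩ := h.exists_matrix hX hY
  obtain ⟨ψ, hψ, hψ'⟩ := h.symm.exists_matrix hY hX
  rw [← Fintype.card_coe A, ← Fintype.card_coe N]
  have hmul : ∀ i i' : A, ¬ (X i').key < (X i).key →
      ∑ j : N, φ i j * ψ j i' = if i = i' then 1 else 0 := by
    intro i i' hkey
    have := h.matrix_mul_apply hδ hX hφ (fun i j hij => (hφ' i j hij).1) hψ
      (fun j i hij => (hψ' j i hij).1) (hA i i.2) (hA i' i'.2) hkey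
    simp only [Subtype.ext_iff]
    rw [← this, sum_eq_sum_subtype_of_ne_zero (fun j => j ∈ N)]
    intro j hj
    have h1 := hφ' i j (left_ne_zero_of_mul hj)
    have h2 := hψ' j i' (right_ne_zero_of_mul hj)
    by_contra hjN
    exact hkey (Bar.key_lt_of_not_close hδ h1.1 h1.2 h2.1 h2.2
      (fun hcl => hjN (hN i i.2 j hcl)) (fun hcl => hjN (hN i' i'.2 j hcl)))
  have hli : LinearIndependent (ZMod 2) (fun (i : A) (j : N) => φ i j) := by
    rw [Fintype.linearIndependent_iff]
    intro c hc
    by_contra! hne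
    -- evaluate a relation at the last bar that occurs in it
    obtain ⟨i', hi', hmax⟩ := Finset.exists_max_image (Finset.univ.filter fun i => c i ≠ 0)
      (fun i => (X i).key) (by
        obtain ⟨i, hi⟩ := hne
        exact ⟨i, by simp [hi]⟩)
    have hzero : ∑ i, c i * ∑ j : N, φ i j * ψ j i' = 0 := by
      have hcomm : ∑ i, c i * ∑ j : N, φ i j * ψ j i' =
          ∑ j : N, (∑ i, c i • fun j : N => φ i j) j * ψ j i' := by
        simp only [Finset.mul_sum, Finset.sum_apply, Pi.smul_apply, smul_eq_mul, Finset.sum_mul]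
        rw [Finset.sum_comm]
        simp only [mul_assoc]
      rw [hcomm, hc]
      simp
    rw [Finset.sum_eq_single i'] at hzero
    · rw [hmul i' i' (lt_irrefl _), if_pos rfl, mul_one] at hzero
      exact (Finset.mem_filter.1 hi').2 hzero
    · intro i _ hii
      by_cases hci : c i = 0
      · rw [hci, zero_mul]
      · rw [hmul i i' (not_lt.2 (hmax i (by simp [hci]))), if_neg hii, mul_zero]
    · simp
  simpa using hli.fintype_card_le_finrank

/-- By Hall's theorem, the long bars of `F` can be matched injectively with close bars of `G`. -/
theorem IsInterleaving.exists_injective (h : IsInterleaving δ F G p a) (hδ : 0 ≤ δ)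
    {m k : ℕ} {X : Fin m → Bar} {Y : Fin k → Bar} (hX : IsBarcode F p X) (hY : IsBarcode G p Y) :
    ∃ f : {i // (X i).LongerThan (2 * δ)} → Fin k, Function.Injective f ∧
      ∀ i : {i // (X i).LongerThan (2 * δ)}, (X i).Close δ (Y (f i)) := by
  classical
  obtain ⟨f, hf, hf'⟩ := (Finset.all_card_le_biUnion_card_iff_exists_injective
    (fun i : {i // (X i).LongerThan (2 * δ)} =>
      Finset.univ.filter fun j => (X i).Close δ (Y j))).1 fun s => by
    rw [← Finset.card_map (Function.Embedding.subtype _)]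
    refine h.card_le hδ hX hY _ _ ?_ ?_
    · intro i hi
      obtain ⟨i, -, rfl⟩ := Finset.mem_map.1 hi
      exact i.2
    · intro i hi j hij
      obtain ⟨i, his, rfl⟩ := Finset.mem_map.1 hi
      exact Finset.mem_biUnion.2 ⟨i, his, by simpa using hij⟩
  exact ⟨f, hf, fun i => by simpa using hf' i⟩

/-- The elements reached by alternating paths that start at an element of `A` outside the image
of `g`. -/
inductive AlternatingReach {α β : Type*} {A : Set α} {B : Set β} (f : A → β) (g : B → α) : α → Prop
  | start (x : A) (hx : ∀ y, g y ≠ x) : AlternatingReach f g x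
  | step (x : A) (hx : AlternatingReach f g x) (y : B) (hy : f x = y) : AlternatingReach f g (g y)

/-- The Mendelsohn–Dulmage theorem: two matchings in a bipartite graph, one covering `A` and one
covering `B`, yield a single matching that covers both `A` and `B`. -/
theorem exists_matching_of_injective {α β : Type*} {A : Set α} {B : Set β} (R : α → β → Prop)
    {f : A → β} {g : B → α} (hf : Function.Injective f) (hg : Function.Injective g)
    (hfR : ∀ x : A, R x (f x)) (hgR : ∀ y : B, R (g y) y) :
    ∃ M : Set (α × β), (∀ x y, (x, y) ∈ M → R x y) ∧
      (∀ x y y', (x, y) ∈ M → (x, y') ∈ M → y = y') ∧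
      (∀ x x' y, (x, y) ∈ M → (x', y) ∈ M → x = x') ∧
      (∀ x ∈ A, ∃ y, (x, y) ∈ M) ∧ ∀ y ∈ B, ∃ x, (x, y) ∈ M := by
  -- use `f` on the reachable elements and the inverse of `g` on the others
  refine ⟨{q | (∃ x : A, AlternatingReach f g x ∧ q = (↑x, f x)) ∨
    ∃ y : B, ¬ AlternatingReach f g (g y) ∧ q = (g y, ↑y)}, ?_, ?_, ?_, ?_, ?_⟩
  · rintro x y (⟨x, -, h⟩ | ⟨y, -, h⟩) <;> cases h
    · exact hfR x
    · exact hgR y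
  · rintro x y y' (⟨x₁, h₁, e₁⟩ | ⟨y₁, h₁, e₁⟩) (⟨x₂, h₂, e₂⟩ | ⟨y₂, h₂, e₂⟩) <;>
      rw [Prod.mk.injEq] at e₁ e₂
    · rw [e₁.2, e₂.2, Subtype.ext (e₁.1.symm.trans e₂.1)]
    · exact absurd (e₂.1 ▸ e₁.1 ▸ h₁) h₂
    · exact absurd (e₁.1 ▸ e₂.1 ▸ h₂) h₁
    · rw [e₁.2, e₂.2, hg (e₁.1.symm.trans e₂.1)]
  · rintro x x' y (⟨x₁, h₁, e₁⟩ | ⟨y₁, h₁, e₁⟩) (⟨x₂, h₂, e₂⟩ | ⟨y₂, h₂, e₂⟩) <;>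
      rw [Prod.mk.injEq] at e₁ e₂
    · rw [e₁.1, e₂.1, hf (e₁.2.symm.trans e₂.2)]
    · exact absurd (.step x₁ h₁ y₂ (e₁.2.symm.trans e₂.2)) h₂
    · exact absurd (.step x₂ h₂ y₁ (e₂.2.symm.trans e₁.2)) h₁
    · rw [e₁.1, e₂.1, Subtype.ext (e₁.2.symm.trans e₂.2)]
  · intro x hx
    by_cases hr : AlternatingReach f g x
    · exact ⟨_, Or.inl ⟨⟨x, hx⟩, hr, rfl⟩⟩
    · have : ∃ y, g y = x := by
        by_contra! hn
        exact hr (.start ⟨x, hx⟩ hn)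
      obtain ⟨y, rfl⟩ := this
      exact ⟨_, Or.inr ⟨y, hr, rfl⟩⟩
  · intro y hy
    by_cases hr : AlternatingReach f g (g ⟨y, hy⟩)
    · generalize hq : g ⟨y, hy⟩ = q at hr
      cases hr with
      | start x hx => exact absurd hq (hx _)
      | step x hx y' hy' =>
        have := congrArg Subtype.val (hg hq)
        exact ⟨x, Or.inl ⟨x, hx, by rw [hy', ← this]⟩⟩
    · exact ⟨_, Or.inr ⟨⟨y, hy⟩, hr, rfl⟩⟩

/-- Algebraic stability: the barcodes of `δ`-interleaved filtrations admit a `δ`-matching. -/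
theorem IsInterleaving.exists_isMatching (h : IsInterleaving δ F G p a) (hδ : 0 ≤ δ)
    {m k : ℕ} {X : Fin m → Bar} {Y : Fin k → Bar} (hX : IsBarcode F p X) (hY : IsBarcode G p Y) :
    ∃ M : Set (Fin m × Fin k), IsMatching δ X Y M := by
  obtain ⟨f, hf, hf'⟩ := h.exists_injective hδ hX hY
  obtain ⟨g, hg, hg'⟩ := h.symm.exists_injective hδ hY hX
  obtain ⟨M, hM, h1, h2, h3, h4⟩ := exists_matching_of_injective
    (A := {i | (X i).LongerThan (2 * δ)}) (B := {j | (Y j).LongerThan (2 * δ)})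
    (fun i j => (X i).Close δ (Y j)) hf hg hf' (fun j => (hg' j).symm)
  exact ⟨M, h1, h2, fun i j hij => (hM i j hij).1, fun i j hij => (hM i j hij).2,
    fun i hi hl => (h3 i hl).elim hi, fun j hj hl => (h4 j hl).elim hj⟩

/-! ### Relabelling of vertices -/

/-- The linear bijection of chain spaces induced by a bijection of the vertices. -/
noncomputable def chainEquiv (e : V ≃ V') : Chain V ≃ₗ[ZMod 2] Chain V' :=
  Finsupp.domLCongr e.finsetCongr

theorem chainEquiv_single (e : V ≃ V') (σ : Finset V) (c : ZMod 2) :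
    chainEquiv e (Finsupp.single σ c) = Finsupp.single (σ.map e.toEmbedding) c := by
  simp [chainEquiv]

theorem boundary_chainEquiv (e : V ≃ V') (x : Chain V) :
    boundary V' (chainEquiv e x) = chainEquiv e (boundary V x) := by
  classical
  induction x using Finsupp.induction_linear with
  | zero => simp
  | add x y hx hy => simp only [map_add, hx, hy]
  | single σ c =>
    simp only [chainEquiv_single, boundary, Finsupp.linearCombination_single, map_smul, map_sum]
    congr 1
    rw [Finset.filter_map, Finset.sum_map]
    have herase : ∀ v, (σ.map e.toEmbedding).erase (e.toEmbedding v) =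
        (σ.erase v).map e.toEmbedding := fun v => (Finset.map_erase _ _ _).symm
    refine Finset.sum_congr (Finset.filter_congr fun v _ => ?_) fun v _ => ?_
    · rw [Function.comp_apply, herase, Finset.map_nonempty]
    · rw [herase]

theorem mem_support_chainEquiv (e : V ≃ V') {x : Chain V} {σ : Finset V'}
    (hσ : σ ∈ (chainEquiv e x).support) : ∃ τ ∈ x.support, σ = τ.map e.toEmbedding := by
  refine ⟨e.finsetCongr.symm σ, ?_, ?_⟩
  · rw [Finsupp.mem_support_iff] at hσ ⊢
    simpa [chainEquiv] using hσ
  · exact (e.finsetCongr.apply_symm_apply σ).symm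

theorem chainEquiv_mem_chains (e : V ≃ V') {K : PreAbstractSimplicialComplex V}
    {L : PreAbstractSimplicialComplex V'} (h : ∀ σ ∈ K, σ.map e.toEmbedding ∈ L) {p : ℕ}
    {x : Chain V} (hx : x ∈ chains K p) : chainEquiv e x ∈ chains L p := by
  intro σ hσ
  obtain ⟨τ, hτ, rfl⟩ := mem_support_chainEquiv e hσ
  have := hx hτ
  exact ⟨h τ this.1, by rw [Finset.card_map]; exact this.2⟩

theorem chainEquiv_mem_cycles (e : V ≃ V') {K : PreAbstractSimplicialComplex V}
    {L : PreAbstractSimplicialComplex V'} (h : ∀ σ ∈ K, σ.map e.toEmbedding ∈ L) {p : ℕ}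
    {x : Chain V} (hx : x ∈ cycles K p) : chainEquiv e x ∈ cycles L p := by
  refine ⟨chainEquiv_mem_chains e h hx.1, ?_⟩
  refine LinearMap.mem_ker.2 ?_
  rw [boundary_chainEquiv, LinearMap.mem_ker.1 hx.2, map_zero]

theorem chainEquiv_mem_boundaries (e : V ≃ V')
    {K : PreAbstractSimplicialComplex V} {L : PreAbstractSimplicialComplex V'}
    (h : ∀ σ ∈ K, σ.map e.toEmbedding ∈ L) {p : ℕ}
    {x : Chain V} (hx : x ∈ boundaries K p) : chainEquiv e x ∈ boundaries L p := by
  obtain ⟨y, hy, rfl⟩ := hx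
  exact ⟨chainEquiv e y, chainEquiv_mem_chains e h hy, boundary_chainEquiv e y⟩

/-! ### Vietoris–Rips filtrations -/

variable [PseudoMetricSpace V]

open Classical in
theorem isFiniteFiltration_rips (P : Finset V) :
    IsFiniteFiltration (rips P) ((P ×ˢ P).image fun q => dist q.1 q.2) where
  step t := by
    -- the scale may be lowered to the largest distance that does not exceed it
    set D := ((P ×ˢ P).image fun q => dist q.1 q.2).filter fun s => s ≤ t with hD
    have hmem : ∀ x ∈ P, ∀ y ∈ P, dist x y ≤ t → dist x y ∈ D := fun x hx y hy h =>
      Finset.mem_filter.2 ⟨Finset.mem_image.2 ⟨(x, y), Finset.mem_product.2 ⟨hx, hy⟩, rfl⟩, h⟩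
    rcases D.eq_empty_or_nonempty with h0 | hne
    · left
      refine le_bot_iff.1 fun σ hσ => ?_
      obtain ⟨⟨x, hx⟩, hP, hd⟩ := hσ
      have := hmem x (hP hx) x (hP hx) (hd x hx x hx)
      rw [h0] at this
      exact absurd this (Finset.notMem_empty _)
    · have hmax := Finset.mem_filter.1 (D.max'_mem hne)
      refine Or.inr ⟨D.max' hne, hmax.1, hmax.2, le_antisymm ((rips P).monotone hmax.2) ?_⟩
      exact fun σ hσ => ⟨hσ.1, hσ.2.1, fun x hx y hy =>
        D.le_max' _ (hmem x (hσ.2.1 hx) y (hσ.2.1 hy) (hσ.2.2 x hx y hy))⟩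
  finite t := P.powerset.finite_toSet.subset fun σ hσ => Finset.mem_coe.2
    (Finset.mem_powerset.2 hσ.2.1)

theorem map_mem_rips {P Q : Finset V} {ε : ℝ} (e : V ≃ V) (heQ : ∀ x ∈ P, e x ∈ Q)
    (heε : ∀ x ∈ P, dist x (e x) ≤ ε) {t : ℝ} (σ : Finset V) (hσ : σ ∈ rips P t) :
    σ.map e.toEmbedding ∈ rips Q (t + 2 * ε) := by
  refine ⟨hσ.1.map, fun y hy => ?_, fun y hy y' hy' => ?_⟩
  · obtain ⟨x, hx, rfl⟩ := Finset.mem_map.1 hy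
    exact heQ x (hσ.2.1 hx)
  · obtain ⟨x, hx, rfl⟩ := Finset.mem_map.1 hy
    obtain ⟨x', hx', rfl⟩ := Finset.mem_map.1 hy'
    have h1 := heε x (hσ.2.1 hx)
    have h2 := heε x' (hσ.2.1 hx')
    have h3 := hσ.2.2 x hx x' hx'
    have h4 := dist_triangle4 (e x) x x' (e x')
    rw [dist_comm] at h1
    change dist (e x) (e x') ≤ _
    linarith

/-- A perturbation is the restriction of a permutation of the ambient space. -/
theorem IsPerturbation.exists_perm {P Q : Finset V} {ε : ℝ} (h : IsPerturbation ε P Q) :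
    ∃ e : V ≃ V, (∀ x ∈ P, e x ∈ Q ∧ dist x (e x) ≤ ε) ∧
      ∀ y ∈ Q, e.symm y ∈ P ∧ dist y (e.symm y) ≤ ε := by
  classical
  obtain ⟨f, hf⟩ := h
  have happ : ∀ x (hx : x ∈ P), f.extendSubtype x = f ⟨x, hx⟩ := fun x hx =>
    f.extendSubtype_apply_of_mem x hx
  refine ⟨f.extendSubtype, fun x hx => ?_, fun y hy => ?_⟩
  · rw [happ x hx]
    exact ⟨(f ⟨x, hx⟩).2, hf ⟨x, hx⟩⟩
  · have hsymm : f.extendSubtype.symm y = f.symm ⟨y, hy⟩ := by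
      rw [Equiv.symm_apply_eq, happ _ (f.symm ⟨y, hy⟩).2]
      simp
    rw [hsymm]
    refine ⟨(f.symm ⟨y, hy⟩).2, ?_⟩
    have := hf (f.symm ⟨y, hy⟩)
    rw [dist_comm]
    simpa using this

/-- A permutation that restricts to an `ε`-perturbation interleaves the Vietoris–Rips
filtrations. -/
theorem isInterleaving_rips {P Q : Finset V} {ε : ℝ} (e : V ≃ V)
    (hP : ∀ x ∈ P, e x ∈ Q ∧ dist x (e x) ≤ ε)
    (hQ : ∀ y ∈ Q, e.symm y ∈ P ∧ dist y (e.symm y) ≤ ε) (p : ℕ) :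
    IsInterleaving (2 * ε) (rips P) (rips Q) p (chainEquiv e) := by
  have h := fun t => map_mem_rips e (fun x hx => (hP x hx).1) (fun x hx => (hP x hx).2) (t := t)
  have h' := fun t => map_mem_rips e.symm (fun x hx => (hQ x hx).1) (fun x hx => (hQ x hx).2)
    (t := t)
  exact ⟨fun t _ hx => chainEquiv_mem_cycles e (h t) hx,
    fun t _ hx => chainEquiv_mem_boundaries e (h t) hx,
    fun t _ hx => chainEquiv_mem_cycles e.symm (h' t) hx,
    fun t _ hx => chainEquiv_mem_boundaries e.symm (h' t) hx⟩

/-! ### Radii -/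

/-- Moving the vertices by at most `ε` increases the radius of a chain by at most `ε`. -/
theorem chainRadius_chainEquiv_le {ε : ℝ} (hε : 0 ≤ ε) (e : V ≃ V) {x : Chain V}
    (h : ∀ σ ∈ x.support, ∀ v ∈ σ, dist v (e v) ≤ ε) :
    chainRadius (chainEquiv e x) ≤ chainRadius x + ENNReal.ofReal ε := by
  simp only [chainRadius, ENNReal.iInf_add]
  refine le_iInf fun c => le_iInf fun ρ => le_iInf fun hρ => ?_
  refine (iInf_le_of_le c (iInf_le_of_le (ρ + ε.toNNReal) (iInf_le_of_le ?_ le_rfl))).trans ?_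
  · intro σ hσ v hv
    obtain ⟨τ, hτ, rfl⟩ := mem_support_chainEquiv e hσ
    obtain ⟨w, hw, rfl⟩ := Finset.mem_map.1 hv
    have h1 := hρ τ hτ w hw
    have h2 := h τ hτ w hw
    have h3 := dist_triangle_left (e w) c w
    rw [NNReal.coe_add, Real.coe_toNNReal ε hε]
    change dist (e w) c ≤ _
    linarith
  · rw [ENNReal.coe_add]
    rfl

/-- Close bars of the filtrations of a point set and of its perturbation: the optimal radius of the
second one, if it is long, bounds the approximate radius of the first one up to `ε`. -/
theorem approxBarRadius_rips_le {P Q : Finset V} {ε : ℝ} (hε : 0 ≤ ε) (e : V ≃ V)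
    (hP : ∀ x ∈ P, e x ∈ Q ∧ dist x (e x) ≤ ε)
    (hQ : ∀ y ∈ Q, e.symm y ∈ P ∧ dist y (e.symm y) ≤ ε) (p : ℕ) {I J : Bar}
    (hIJ : I.Close (2 * ε) J) (hJ : J.LongerThan (4 * ε)) :
    approxBarRadius (rips P) p (4 * ε) I ≤ barRadius (rips Q) p J + ENNReal.ofReal ε := by
  have h4 : 4 * ε = 2 * (2 * ε) := by ring
  rw [h4] at hJ ⊢
  simp only [barRadius, ENNReal.iInf_add]
  refine le_iInf fun ζ => le_iInf fun hζ => ?_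
  refine (iInf₂_le _ ((isInterleaving_rips e hP hQ p).isApproxRepresentative
    (isFiniteFiltration_rips P) hIJ hJ hζ)).trans ?_
  refine chainRadius_chainEquiv_le hε e.symm fun σ hσ v hv => ?_
  obtain ⟨m, X, z, hX, j, -, rfl⟩ := hζ
  have hface := ((hX.cycle j).1 hσ).1
  exact (hQ v (hface.2.1 hv)).2

end RipsStability

theorem mainTheorem2 (n : ℕ) (P Q : Finset (EuclideanSpace ℝ (Fin n))) (ε : ℝ) (hε : 0 ≤ ε)
    (hPQ : RipsStability.IsPerturbation ε P Q) (p : ℕ) :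
    (∃ (m : ℕ) (X : Fin m → RipsStability.Bar),
      RipsStability.IsBarcode (RipsStability.rips P) p X) ∧
    (∃ (k : ℕ) (Y : Fin k → RipsStability.Bar),
      RipsStability.IsBarcode (RipsStability.rips Q) p Y) ∧
    ∀ (m k : ℕ) (X : Fin m → RipsStability.Bar) (Y : Fin k → RipsStability.Bar),
      RipsStability.IsBarcode (RipsStability.rips P) p X →
      RipsStability.IsBarcode (RipsStability.rips Q) p Y →
      ∃ M : Set (Fin m × Fin k),
        RipsStability.IsMatching (2 * ε) X Y M ∧
        ∀ i j, (i, j) ∈ M → (X i).LongerThan (4 * ε) → (Y j).LongerThan (4 * ε) →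
          RipsStability.approxBarRadius (RipsStability.rips P) p (4 * ε) (X i) ≤
            RipsStability.barRadius (RipsStability.rips Q) p (Y j) + ENNReal.ofReal ε ∧
          RipsStability.approxBarRadius (RipsStability.rips Q) p (4 * ε) (Y j) ≤
            RipsStability.barRadius (RipsStability.rips P) p (X i) + ENNReal.ofReal ε := by
  refine ⟨(RipsStability.isFiniteFiltration_rips P).exists_isBarcode p,
    (RipsStability.isFiniteFiltration_rips Q).exists_isBarcode p, fun m k X Y hX hY => ?_⟩
  obtain ⟨e, hP, hQ⟩ := hPQ.exists_perm
  obtain ⟨M, hM⟩ :=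
    (RipsStability.isInterleaving_rips e hP hQ p).exists_isMatching (by positivity) hX hY
  refine ⟨M, hM, fun i j hij hi hj => ?_⟩
  have hclose : (X i).Close (2 * ε) (Y j) := ⟨hM.birth_close i j hij, hM.death_close i j hij⟩
  exact ⟨RipsStability.approxBarRadius_rips_le hε e hP hQ p hclose hj,
    RipsStability.approxBarRadius_rips_le hε e.symm hQ hP p hclose.symm hi⟩
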